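/- Let $T>0$ and let $f\in C^0([0,T];C^2(\mathbb R^3))$, $g\in C^2(\mathbb R^3)$ satisfy $\|f(\cdot,s)\|_{C^2}+\|g\|_{C^2}\le C$ for all $s\in[0,T]$ and some constant $C$, where $\|h\|_{C^2}=\sup_{x\in\mathbb R^3}\big(|h(x)|+|Dh(x)|+|D^2h(x)|\big)$. Fix $\varepsilon\in\mathbb R$. For $x\in\mathbb R^3$ and $t\in[0,T)$ let $\mathcal A_\varepsilon(x,t)$ be the set of pairs $(x(\cdot),\alpha)\in AC([t,T];\mathbb R^3)\times L^2([t,T];\mathbb R^3)$ with $x(t)=x$ and, for a.e. $s\in[t,T]$, $$x_1'=\alpha_1,\qquad x_2'=\alpha_2,\qquad x_3'=-x_2\alpha_1+x_1\alpha_2+\varepsilon\alpha_3 .$$ Let $$u_\varepsilon(x,t)=\inf_{(x(\cdot),\alpha)\in\mathcal A_\varepsilon(x,t)}\left\{\int_t^T\Big(\tfrac12|\alpha(s)|^2+f(x(s),s)\Big)\,ds+g(x(T))\right\}.$$ A curve $x^*(\cdot)$ is called an optimal trajectory for $u_\varepsilon(x,t)$ if for some control $\alpha^*$ the pair $(x^*(\cdot),\alpha^*)$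 belongs to $\mathcal A_\varepsilon(x,t)$ and attains this infimum. **Proposition 3.3.** Suppose $\varepsilon\neq0$. Let $x\in\mathbb R^3$, $t\in[0,T)$, and let $x^*(\cdot)$ be an optimal trajectory for $u_\varepsilon(x,t)$. Then for every $\tau$ with $t<\tau<T$, the restriction of $x^*(\cdot)$ to $[\tau,T]$ is an optimal trajectory for $u_\varepsilon(x^*(\tau),\tau)$, and it is the only one. -/

import Mathlib

open MeasureTheory Set Filter Topology
open scoped ENNReal

namespace HeisenbergControl

/-- The state (and control) space `ℝ³` with its Euclidean norm.
Coordinates `x₁, x₂, x₃` are `x 0, x 1, x 2`. -/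
abbrev R3 : Type := EuclideanSpace ℝ (Fin 3)

/-- The norm `sup_x (|h x| + |Dh x| + |D²h x|)`, with value `∞` when the supremum is infinite. -/
noncomputable def c2Norm {E : Type*} [NormedAddCommGroup E] [NormedSpace ℝ E] (h : E → ℝ) :
    ℝ≥0∞ :=
  ⨆ x : E, (‖h x‖ₑ + ‖fderiv ℝ h x‖ₑ + ‖fderiv ℝ (fderiv ℝ h) x‖ₑ)

/-- Standing hypothesis on the running cost `f` (time is the first argument, only times in
`[0, T]` matter) and the terminal cost `g`:
`f ∈ C⁰([0, T]; C²(ℝ³))`, `g ∈ C²(ℝ³)`, with a uniform bound on the `C²` norms. -/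
structure CostHypothesis (T : ℝ) (f : ℝ → R3 → ℝ) (g : R3 → ℝ) : Prop where
  f_contDiff : ∀ s ∈ Icc 0 T, ContDiff ℝ 2 (f s)
  f_continuous : ∀ s ∈ Icc 0 T,
    Tendsto (fun r => c2Norm (fun x => f r x - f s x)) (𝓝[Icc 0 T] s) (𝓝 0)
  g_contDiff : ContDiff ℝ 2 g
  bound : ∃ C : ℝ, ∀ s ∈ Icc 0 T, c2Norm (f s) + c2Norm g ≤ ENNReal.ofReal C

/-- The velocity `B^ε(x) a`, where `B^ε(x)` has rows `(1, 0, 0)`, `(0, 1, 0)`, `(-x₂, x₁, ε)`. -/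
noncomputable def velocity (ε : ℝ) (x a : R3) : R3 :=
  !₂[a 0, a 1, -x 1 * a 0 + x 0 * a 1 + ε * a 2]

/-- `(γ, α)` is admissible from `x` at time `t`: `γ ∈ AC([t, T]; ℝ³)`, `α ∈ L²([t, T]; ℝ³)`,
`γ(t) = x` and `γ'(s) = B^ε(γ(s)) α(s)` for a.e. `s ∈ [t, T]`.
Only the values on `[t, T]` matter. -/
structure IsAdmissible (ε T : ℝ) (x : R3) (t : ℝ) (γ α : ℝ → R3) : Prop where
  absCont : AbsolutelyContinuousOnInterval γ t T
  memLp : MemLp α 2 (volume.restrict (Icc t T))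
  initial : γ t = x
  dynamics : ∀ᵐ s ∂(volume.restrict (Icc t T)), HasDerivAt γ (velocity ε (γ s) (α s)) s

/-- The cost `∫ₜᵀ (½ |α(s)|² + f(γ(s), s)) ds + g(γ(T))`. -/
noncomputable def cost (T : ℝ) (f : ℝ → R3 → ℝ) (g : R3 → ℝ) (t : ℝ) (γ α : ℝ → R3) : ℝ :=
  (∫ s in t..T, ((1 / 2 : ℝ) * ‖α s‖ ^ 2 + f s (γ s))) + g (γ T)

/-- `(γ, α)` minimizes the cost among all pairs admissible from `x` at time `t`, that is, it
attains the infimum `u_ε(x, t)`. -/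
def IsOptimalPair (ε T : ℝ) (f : ℝ → R3 → ℝ) (g : R3 → ℝ) (x : R3) (t : ℝ)
    (γ α : ℝ → R3) : Prop :=
  IsAdmissible ε T x t γ α ∧
    ∀ η β : ℝ → R3, IsAdmissible ε T x t η β → cost T f g t γ α ≤ cost T f g t η β

/-- `γ` is an optimal trajectory for `u_ε(x, t)`: some control makes it an optimal pair. -/
def IsOptimalTrajectory (ε T : ℝ) (f : ℝ → R3 → ℝ) (g : R3 → ℝ) (x : R3) (t : ℝ)
    (γ : ℝ → R3) : Prop :=
  ∃ α : ℝ → R3, IsOptimalPair ε T f g x t γ α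

end HeisenbergControl

/-! By dynamic programming, the tail of an optimal pair is optimal (`IsOptimalPair.restrict`), and
replacing that tail by any other optimal one after `τ` keeps the whole pair optimal from `(x, t)`
(`IsOptimalPair.concat`). So it suffices that two optimal pairs from `(x, t)` which coincide on `[t,
τ]` do not branch afterwards (`IsOptimalPair.eqOn_of_eqOn`).

For `ε ≠ 0` the matrix `B^ε(x)` has determinant `ε`, so it is invertible and a trajectory may be
perturbed in any direction. Vanishing of the first variation, combined with the du Bois-Reymond
lemma, yields a continuous costate `p` with `α = B^ε(γ)ᵀ p` a.e., and `(γ, p)` solves the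
Hamiltonian system of `H = ½|B^ε(x)ᵀ p|² - f`, whose vector field is locally Lipschitz in `(x, p)`
(`IsOptimalPair.exists_costate`).

The common control on `[t, τ]` and injectivity of `B^ε(x)ᵀ` force the two costates to agree at some
time `σ ≤ τ`. Both pairs `(γ, p)` then solve one Cauchy problem from `σ`, and ODE uniqueness
finishes. The strict inequality `t < τ` is what provides such a `σ`; no transversality condition at
`T` is needed. -/

namespace HeisenbergControl

/-! ### Absolutely continuous curves, primitives, and the du Bois-Reymond lemma -/

section Calculus

theorem absolutelyContinuousOnInterval_congr {X : Type*} [PseudoMetricSpace X] {f g : ℝ → X}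
    {a b : ℝ} (hf : AbsolutelyContinuousOnInterval f a b) (h : EqOn f g (uIcc a b)) :
    AbsolutelyContinuousOnInterval g a b := by
  rw [absolutelyContinuousOnInterval_iff] at hf ⊢
  intro e he
  obtain ⟨δ, hδ, H⟩ := hf e he
  refine ⟨δ, hδ, fun E hE hl => ?_⟩
  have := H E hE hl
  refine lt_of_eq_of_lt (Finset.sum_congr rfl fun i hi => ?_) this
  rw [h (hE.1 i hi).1, h (hE.1 i hi).2]

theorem absolutelyContinuousOnInterval_const {X : Type*} [PseudoMetricSpace X] (c : X) (a b : ℝ) :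
    AbsolutelyContinuousOnInterval (fun _ => c) a b :=
  LipschitzOnWith.absolutelyContinuousOnInterval (K := 0) (LipschitzWith.const c).lipschitzOnWith

theorem intervalIntegral_euclidean_apply {v : ℝ → R3} {a b : ℝ}
    (hv : IntervalIntegrable v volume a b) (i : Fin 3) :
    (∫ s in a..b, v s) i = ∫ s in a..b, v s i :=
  ((EuclideanSpace.proj i : R3 →L[ℝ] ℝ).intervalIntegral_comp_comm hv).symm

theorem intervalIntegrable_euclidean_apply {v : ℝ → R3} {a b : ℝ}
    (hv : IntervalIntegrable v volume a b) (i : Fin 3) :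
    IntervalIntegrable (fun s => v s i) volume a b :=
  ⟨hv.1.eval_piLp i, hv.2.eval_piLp i⟩

theorem intervalIntegrable_mono_Icc {E : Type*} [NormedAddCommGroup E] {v : ℝ → E} {a b c d : ℝ}
    (hv : IntervalIntegrable v volume a b) (hab : a ≤ b) (hc : c ∈ Icc a b) (hd : d ∈ Icc a b) :
    IntervalIntegrable v volume c d :=
  hv.mono_set (by rw [uIcc_of_le hab]; exact uIcc_subset_Icc hc hd)

theorem absolutelyContinuousOnInterval_of_apply {f : ℝ → R3} {a b : ℝ}
    (hf : ∀ i, AbsolutelyContinuousOnInterval (fun s => f s i) a b) :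
    AbsolutelyContinuousOnInterval f a b := by
  have h : ∀ i, AbsolutelyContinuousOnInterval
      (fun s => (f s i) • (EuclideanSpace.single i (1 : ℝ) : R3)) a b := fun i =>
    (hf i).fun_smul (absolutelyContinuousOnInterval_const _ a b)
  refine absolutelyContinuousOnInterval_congr (((h 0).add (h 1)).add (h 2)) fun s _ => ?_
  ext i
  fin_cases i <;> simp

theorem absolutelyContinuousOnInterval_integral {v : ℝ → R3} {a b : ℝ} (hab : a ≤ b)
    (hv : IntervalIntegrable v volume a b) :
    AbsolutelyContinuousOnInterval (fun s => ∫ r in a..s, v r) a b := by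
  refine absolutelyContinuousOnInterval_of_apply fun i => ?_
  refine absolutelyContinuousOnInterval_congr
    ((intervalIntegrable_euclidean_apply hv i).absolutelyContinuousOnInterval_intervalIntegral
      (left_mem_uIcc)) fun s hs => ?_
  rw [uIcc_of_le hab] at hs
  exact (intervalIntegral_euclidean_apply
    (intervalIntegrable_mono_Icc hv hab ⟨le_rfl, hab⟩ hs) i).symm

/-- The difference of `f` and the primitive of `v` is absolutely continuous with derivative zero
a.e., hence constant. -/
theorem eq_add_integral_of_ae_hasDerivAt {f v : ℝ → R3} {a b : ℝ} (hab : a ≤ b)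
    (hf : AbsolutelyContinuousOnInterval f a b) (hv : IntervalIntegrable v volume a b)
    (hd : ∀ᵐ s ∂(volume.restrict (Icc a b)), HasDerivAt f (v s) s) :
    ∀ s ∈ Icc a b, f s = f a + ∫ r in a..s, v r := by
  rw [ae_restrict_iff' measurableSet_Icc] at hd
  have hac := hf.sub (absolutelyContinuousOnInterval_integral hab hv)
  have h0 : ∀ᵐ s, s ∈ uIcc a b →
      HasDerivAt (f - fun s => ∫ r in a..s, v r) 0 s := by
    filter_upwards [hd, hv.ae_hasDerivAt_integral] with s h1 h2 hs
    have := (h1 (by rwa [uIcc_of_le hab] at hs)).sub (h2 hs a left_mem_uIcc)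
    rwa [sub_self] at this
  obtain ⟨c, hc⟩ := hac.const_of_ae_hasDerivAt_zero h0
  rw [uIcc_of_le hab] at hc
  intro s hs
  have h1 := hc s hs
  have h2 := hc a ⟨le_rfl, hab⟩
  simp only [Pi.sub_apply, intervalIntegral.integral_same, sub_zero] at h1 h2
  rw [h2, ← h1]; abel

/-- Upgrades an integral equation with continuous integrand to a derivative at every time, in the
one-sided form used by ODE uniqueness. Extending `v` by constants outside `[a, b]` makes the
fundamental theorem applicable at the endpoint `a` too. -/
theorem hasDerivWithinAt_Ici_of_eq_add_integral {E : Type*} [NormedAddCommGroup E]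
    [NormedSpace ℝ E] [CompleteSpace E] {f v : ℝ → E} {a b : ℝ}
    (hv : ContinuousOn v (Icc a b)) (hf : ∀ s ∈ Icc a b, f s = f a + ∫ r in a..s, v r)
    {s : ℝ} (hs : s ∈ Ico a b) : HasDerivWithinAt f (v s) (Ici s) s := by
  have hab : a ≤ b := hs.1.trans hs.2.le
  have hc : Continuous (IccExtend hab ((Icc a b).domRestrict v)) :=
    hv.domRestrict.Icc_extend'
  have h1 : HasDerivAt (fun s => f a + ∫ r in a..s, IccExtend hab ((Icc a b).domRestrict v) r)
      (IccExtend hab ((Icc a b).domRestrict v) s) s :=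
    (intervalIntegral.integral_hasDerivAt_right (hc.intervalIntegrable _ _)
      (hc.stronglyMeasurableAtFilter _ _) hc.continuousAt).const_add _
  have hval : ∀ r ∈ Icc a b, IccExtend hab ((Icc a b).domRestrict v) r = v r := fun r hr => by
    rw [IccExtend_of_mem hab _ hr]; rfl
  rw [hval s ⟨hs.1, hs.2.le⟩] at h1
  have hfe : ∀ r ∈ Icc a b,
      f r = f a + ∫ r in a..r, IccExtend hab ((Icc a b).domRestrict v) r := fun r hr => by
    rw [hf r hr]
    congr 1
    refine intervalIntegral.integral_congr fun q hq => ?_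
    rw [uIcc_of_le hr.1] at hq
    exact (hval q ⟨hq.1, hq.2.trans hr.2⟩).symm
  refine h1.hasDerivWithinAt.congr_of_eventuallyEq ?_ (hfe s ⟨hs.1, hs.2.le⟩)
  filter_upwards [Icc_mem_nhdsGE hs.2] with r hr
  exact hfe r ⟨hs.1.trans hr.1, hr.2⟩

/-- The lemma of du Bois-Reymond. -/
theorem ae_eq_const_add_integral_of_forall_integral_eq_zero {m n : ℝ → ℝ} {a b : ℝ} (hab : a < b)
    (hm : IntervalIntegrable m volume a b) (hn : IntervalIntegrable n volume a b)
    (h : ∀ χ : ℝ → ℝ, Continuous χ → ∫ s in a..b, χ s = 0 →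
      ∫ s in a..b, (m s * χ s + n s * ∫ r in a..s, χ r) = 0) :
    ∃ c : ℝ, ∀ᵐ s ∂(volume.restrict (Icc a b)), m s = c + ∫ r in a..s, n r := by
  set N : ℝ → ℝ := fun s => ∫ r in a..s, n r with hN
  have hNac : AbsolutelyContinuousOnInterval N a b :=
    hn.absolutelyContinuousOnInterval_intervalIntegral left_mem_uIcc
  have hNi : IntervalIntegrable N volume a b := hNac.continuousOn.intervalIntegrable
  have hq : IntervalIntegrable (fun s => m s - N s) volume a b := hm.sub hNi
  -- Integrating `n` against the primitive of `χ` by parts moves everything onto `χ`; boundary terms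
  -- vanish because that primitive is zero at both ends.
  have key : ∀ χ : ℝ → ℝ, Continuous χ → ∫ s in a..b, χ s = 0 →
      ∫ s in a..b, (m s - N s) * χ s = 0 := by
    intro χ hχ h0
    set ψ : ℝ → ℝ := fun s => ∫ r in a..s, χ r with hψ
    have hψd : ∀ s, HasDerivAt ψ (χ s) s := fun s =>
      intervalIntegral.integral_hasDerivAt_right (hχ.intervalIntegrable _ _)
        (hχ.stronglyMeasurableAtFilter _ _) hχ.continuousAt
    have hψc : Continuous ψ := continuous_iff_continuousAt.2 fun s => (hψd s).continuousAt
    have hψac : AbsolutelyContinuousOnInterval ψ a b :=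
      (hχ.intervalIntegrable a b).absolutelyContinuousOnInterval_intervalIntegral left_mem_uIcc
    have hparts := hNac.integral_mul_deriv_eq_deriv_mul hψac
    have e1 : ∫ s in a..b, N s * deriv ψ s = ∫ s in a..b, N s * χ s := by
      simp_rw [(hψd _).deriv]
    have e2 : ∫ s in a..b, deriv N s * ψ s = ∫ s in a..b, n s * ψ s := by
      refine intervalIntegral.integral_congr_ae ?_
      filter_upwards [hn.ae_hasDerivAt_integral] with s hs hs'
      rw [(hs (uIoc_subset_uIcc hs') a left_mem_uIcc).deriv]
    have e3 : N b * ψ b - N a * ψ a = 0 := by simp [hψ, hN, h0]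
    rw [e1, e2, e3] at hparts
    have h1 := h χ hχ h0
    have i1 : IntervalIntegrable (fun s => m s * χ s) volume a b := hm.mul_continuousOn
      hχ.continuousOn
    have i2 : IntervalIntegrable (fun s => n s * ψ s) volume a b := hn.mul_continuousOn
      hψc.continuousOn
    have i3 : IntervalIntegrable (fun s => N s * χ s) volume a b := hNi.mul_continuousOn
      hχ.continuousOn
    rw [intervalIntegral.integral_add i1 i2] at h1
    simp_rw [sub_mul]
    rw [intervalIntegral.integral_sub i1 i3]
    linarith
  -- The mean of `m - N`: with this choice, subtracting its mean from an arbitrary `χ` removes the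
  -- mean-zero restriction.
  set c : ℝ := (∫ s in a..b, (m s - N s)) / (b - a) with hc
  have hba : b - a ≠ 0 := (sub_pos.2 hab).ne'
  have key2 : ∀ χ : ℝ → ℝ, Continuous χ → ∫ s in a..b, (m s - N s - c) * χ s = 0 := by
    intro χ hχ
    set k : ℝ := (∫ s in a..b, χ s) / (b - a) with hk
    have h1 := key (fun s => χ s - k) (hχ.sub continuous_const) (by
      rw [intervalIntegral.integral_sub (hχ.intervalIntegrable _ _) (by simp)]
      simp only [intervalIntegral.integral_const, smul_eq_mul, hk]
      field_simp; ring)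
    have i1 : IntervalIntegrable (fun s => (m s - N s) * χ s) volume a b :=
      hq.mul_continuousOn hχ.continuousOn
    simp_rw [mul_sub] at h1
    simp_rw [sub_mul _ c]
    rw [intervalIntegral.integral_sub i1 (hq.mul_const k)] at h1
    rw [intervalIntegral.integral_sub i1 ((hχ.intervalIntegrable _ _).const_mul c)]
    rw [intervalIntegral.integral_mul_const] at h1
    rw [intervalIntegral.integral_const_mul]
    have e : (∫ s in a..b, (m s - N s)) * k = c * ∫ s in a..b, χ s := by
      rw [hc, hk]; ring
    linarith
  have hint : IntegrableOn (fun s => m s - N s - c) (Ioo a b) volume := by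
    have := (hq.sub (intervalIntegrable_const (c := c))).1
    exact this.mono_set Ioo_subset_Ioc_self
  have hae := isOpen_Ioo.ae_eq_zero_of_integral_contDiff_smul_eq_zero
    (f := fun s => m s - N s - c) (U := Ioo a b) hint.locallyIntegrableOn (by
      intro χ hχ _ hsupp
      have h1 := key2 χ hχ.continuous
      rw [intervalIntegral.integral_of_le hab.le, integral_Ioc_eq_integral_Ioo] at h1
      rw [← h1, ← setIntegral_eq_integral_of_forall_compl_eq_zero (s := Ioo a b)]
      · simp only [smul_eq_mul, mul_comm]
      · intro s hs
        rw [image_eq_zero_of_notMem_tsupport (fun h' => hs (hsupp h')), zero_smul])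
  refine ⟨c, ?_⟩
  rw [← restrict_Ioo_eq_restrict_Icc, ae_restrict_iff' measurableSet_Ioo]
  filter_upwards [hae] with s hs hs'
  linarith [hs hs']

end Calculus

/-! ### Regularity of the running cost -/

section Cost

variable {T : ℝ} {f : ℝ → R3 → ℝ} {g : R3 → ℝ}

theorem CostHypothesis.exists_bound (h : CostHypothesis T f g) :
    ∃ C : NNReal, ∀ s ∈ Icc 0 T, ∀ x,
      ‖fderiv ℝ (f s) x‖₊ ≤ C ∧ ‖fderiv ℝ (fderiv ℝ (f s)) x‖₊ ≤ C := by
  obtain ⟨C, hC⟩ := h.bound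
  refine ⟨C.toNNReal, fun s hs x => ?_⟩
  have h1 : ‖f s x‖ₑ + ‖fderiv ℝ (f s) x‖ₑ + ‖fderiv ℝ (fderiv ℝ (f s)) x‖ₑ ≤
      ENNReal.ofReal C :=
    ((le_iSup (fun x => ‖f s x‖ₑ + ‖fderiv ℝ (f s) x‖ₑ + ‖fderiv ℝ (fderiv ℝ (f s)) x‖ₑ)
      x).trans le_self_add).trans (hC s hs)
  constructor
  · exact ENNReal.coe_le_coe.1 ((le_add_self.trans le_self_add).trans h1)
  · exact ENNReal.coe_le_coe.1 (le_add_self.trans h1)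

theorem CostHypothesis.differentiable (h : CostHypothesis T f g) {s : ℝ} (hs : s ∈ Icc 0 T) :
    Differentiable ℝ (f s) :=
  (h.f_contDiff s hs).differentiable (by norm_num)

theorem CostHypothesis.exists_lipschitz (h : CostHypothesis T f g) :
    ∃ C : NNReal, ∀ s ∈ Icc 0 T, LipschitzWith C (f s) ∧ LipschitzWith C (fderiv ℝ (f s)) := by
  obtain ⟨C, hC⟩ := h.exists_bound
  refine ⟨C, fun s hs => ⟨?_, ?_⟩⟩
  · exact lipschitzWith_of_nnnorm_fderiv_le (h.differentiable hs) fun x => (hC s hs x).1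
  · exact lipschitzWith_of_nnnorm_fderiv_le
      (((h.f_contDiff s hs).fderiv_right (m := 1) (by norm_num)).differentiable (by norm_num))
      fun x => (hC s hs x).2

/-- Joint continuity follows from a Lipschitz bound in space uniform in time, plus continuity in
time at each fixed point, where the difference is dominated by `c2Norm`. -/
theorem CostHypothesis.continuousOn (h : CostHypothesis T f g) :
    ContinuousOn (fun p : ℝ × R3 => f p.1 p.2) (Icc 0 T ×ˢ univ) := by
  obtain ⟨C, hC⟩ := h.exists_lipschitz
  refine continuousOn_prod_of_continuousOn_lipschitzOnWith' _ C
    (fun s hs => (hC s hs).1.lipschitzOnWith) fun x _ s hs => ?_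
  refine tendsto_iff_edist_tendsto_0.2 ?_
  refine tendsto_of_tendsto_of_tendsto_of_le_of_le tendsto_const_nhds (h.f_continuous s hs)
    (fun _ => zero_le) fun r => ?_
  rw [edist_eq_enorm_sub]
  exact (le_self_add.trans le_self_add).trans (le_iSup (fun x => ‖f r x - f s x‖ₑ +
    ‖fderiv ℝ (fun x => f r x - f s x) x‖ₑ +
    ‖fderiv ℝ (fderiv ℝ (fun x => f r x - f s x)) x‖ₑ) x)

theorem CostHypothesis.continuousOn_fderiv (h : CostHypothesis T f g) :
    ContinuousOn (fun p : ℝ × R3 => fderiv ℝ (f p.1) p.2) (Icc 0 T ×ˢ univ) := by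
  obtain ⟨C, hC⟩ := h.exists_lipschitz
  refine continuousOn_prod_of_continuousOn_lipschitzOnWith' _ C
    (fun s hs => (hC s hs).2.lipschitzOnWith) fun x _ s hs => ?_
  refine tendsto_iff_edist_tendsto_0.2 ?_
  refine tendsto_of_tendsto_of_tendsto_of_le_of_le' tendsto_const_nhds (h.f_continuous s hs)
    (Eventually.of_forall fun _ => zero_le) ?_
  filter_upwards [self_mem_nhdsWithin] with r hr
  rw [edist_eq_enorm_sub, ← fderiv_fun_sub (h.differentiable hr x) (h.differentiable hs x)]
  exact (le_add_self.trans le_self_add).trans (le_iSup (fun x => ‖f r x - f s x‖ₑ +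
    ‖fderiv ℝ (fun x => f r x - f s x) x‖ₑ +
    ‖fderiv ℝ (fderiv ℝ (fun x => f r x - f s x)) x‖ₑ) x)

/-- Along a curve in `[0, T] × ℝ³`, `s ↦ (s, γ s)` stays in the domain of the running cost. -/
theorem continuousOn_graph {E : Type*} [TopologicalSpace E] {F : ℝ × R3 → E}
    (hF : ContinuousOn F (Icc 0 T ×ˢ univ)) {a b : ℝ} (ha : 0 ≤ a) (hb : b ≤ T) {γ : ℝ → R3}
    (hγ : ContinuousOn γ (Icc a b)) : ContinuousOn (fun s => F (s, γ s)) (Icc a b) :=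
  hF.comp (continuousOn_id.prodMk hγ) fun _ hs => ⟨⟨ha.trans hs.1, hs.2.trans hb⟩, mem_univ _⟩

/-- Mean value inequality on the ball of radius `‖v‖` about `x`, where the derivative varies by at
most `C * ‖v‖`. Only an upper bound is needed, since competitors are compared with a minimizer. -/
theorem CostHypothesis.exists_quadratic_upper_bound (h : CostHypothesis T f g) :
    ∃ C : ℝ, ∀ s ∈ Icc 0 T, ∀ x v, f s (x + v) ≤ f s x + fderiv ℝ (f s) x v + C * ‖v‖ ^ 2 := by
  obtain ⟨C, hC⟩ := h.exists_lipschitz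
  refine ⟨C, fun s hs x v => ?_⟩
  have h1 := (convex_closedBall x ‖v‖).norm_image_sub_le_of_norm_fderiv_le' (𝕜 := ℝ) (f := f s)
    (φ := fderiv ℝ (f s) x) (C := C * ‖v‖) (x := x) (y := x + v)
    (fun y _ => h.differentiable hs y) (fun y hy => by
      have h2 := (hC s hs).2.norm_sub_le y x
      rw [mem_closedBall_iff_norm] at hy
      exact h2.trans (by gcongr)) (by simp) (by simp)
  rw [add_sub_cancel_left, Real.norm_eq_abs] at h1
  have h3 := (le_abs_self _).trans h1
  rw [mul_assoc, ← sq] at h3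
  linarith

end Cost

/-! ### Admissible pairs, concatenation and dynamic programming -/

section Admissible

variable {ε T t : ℝ} {x : R3} {γ α : ℝ → R3}

theorem IsAdmissible.continuousOn (h : IsAdmissible ε T x t γ α) (htT : t ≤ T) :
    ContinuousOn γ (Icc t T) := by
  have := h.absCont.continuousOn
  rwa [uIcc_of_le htT] at this

theorem intervalIntegrable_of_memLp_two {E : Type*} [NormedAddCommGroup E] {u : ℝ → E} {a b : ℝ}
    (hab : a ≤ b) (hu : MemLp u 2 (volume.restrict (Icc a b))) :
    IntervalIntegrable u volume a b :=
  (intervalIntegrable_iff_integrableOn_Icc_of_le hab).2 (hu.integrable (by norm_num))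

theorem intervalIntegrable_mul_of_memLp_two {u v : ℝ → ℝ} {a b : ℝ} (hab : a ≤ b)
    (hu : MemLp u 2 (volume.restrict (Icc a b))) (hv : MemLp v 2 (volume.restrict (Icc a b))) :
    IntervalIntegrable (fun s => u s * v s) volume a b :=
  (intervalIntegrable_iff_integrableOn_Icc_of_le hab).2 (hu.integrable_mul hv)

theorem memLp_two_continuousOn_mul {c u : ℝ → ℝ} {a b : ℝ} (hc : ContinuousOn c (Icc a b))
    (hu : MemLp u 2 (volume.restrict (Icc a b))) :
    MemLp (fun s => c s * u s) 2 (volume.restrict (Icc a b)) := by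
  obtain ⟨K, hK⟩ := isCompact_Icc.exists_bound_of_continuousOn hc
  refine hu.of_le_mul (c := K) ((hc.aestronglyMeasurable measurableSet_Icc).mul hu.1) ?_
  filter_upwards [ae_restrict_mem measurableSet_Icc] with s hs
  rw [norm_mul]
  exact mul_le_mul_of_nonneg_right (hK s hs) (norm_nonneg _)

theorem memLp_two_of_continuousOn {E : Type*} [NormedAddCommGroup E] {c : ℝ → E} {a b : ℝ}
    (hc : ContinuousOn c (Icc a b)) : MemLp c 2 (volume.restrict (Icc a b)) := by
  obtain ⟨K, hK⟩ := isCompact_Icc.exists_bound_of_continuousOn hc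
  refine MemLp.of_bound (hc.aestronglyMeasurable_of_isCompact isCompact_Icc measurableSet_Icc) K ?_
  filter_upwards [ae_restrict_mem measurableSet_Icc] with s hs
  exact hK s hs

theorem IsAdmissible.continuousOn_apply (h : IsAdmissible ε T x t γ α) (htT : t ≤ T) (i : Fin 3) :
    ContinuousOn (fun s => γ s i) (Icc t T) :=
  (EuclideanSpace.proj i : R3 →L[ℝ] ℝ).continuous.comp_continuousOn (h.continuousOn htT)

theorem IsAdmissible.intervalIntegrable_velocity (h : IsAdmissible ε T x t γ α) (htT : t ≤ T) :
    IntervalIntegrable (fun s => velocity ε (γ s) (α s)) volume t T := by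
  have hα := fun i => h.memLp.eval_piLp i
  have hγ := h.continuousOn_apply htT
  refine intervalIntegrable_of_memLp_two htT (MemLp.of_eval_piLp fun i => ?_)
  fin_cases i
  · simpa [velocity] using hα 0
  · simpa [velocity] using hα 1
  · have := ((memLp_two_continuousOn_mul (hγ 1).neg (hα 0)).add
      (memLp_two_continuousOn_mul (hγ 0) (hα 1))).add ((hα 2).const_mul ε)
    simpa [velocity] using! this

theorem IsAdmissible.eq_add_integral (h : IsAdmissible ε T x t γ α) (htT : t ≤ T) :
    ∀ s ∈ Icc t T, γ s = x + ∫ r in t..s, velocity ε (γ r) (α r) := by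
  rw [← h.initial]
  exact eq_add_integral_of_ae_hasDerivAt htT h.absCont (h.intervalIntegrable_velocity htT)
    h.dynamics

theorem IsAdmissible.intervalIntegrable_cost {f : ℝ → R3 → ℝ} {g : R3 → ℝ}
    (h : IsAdmissible ε T x t γ α) (hfg : CostHypothesis T f g) (ht : 0 ≤ t) (htT : t ≤ T) :
    IntervalIntegrable (fun s => (1 / 2 : ℝ) * ‖α s‖ ^ 2 + f s (γ s)) volume t T := by
  refine IntervalIntegrable.add ?_ ?_
  · exact ((intervalIntegrable_iff_integrableOn_Icc_of_le htT).2
      h.memLp.norm.integrable_sq).const_mul _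
  · refine ContinuousOn.intervalIntegrable ?_
    rw [uIcc_of_le htT]
    exact continuousOn_graph hfg.continuousOn ht le_rfl (h.continuousOn htT)

theorem IsAdmissible.restrict (h : IsAdmissible ε T x t γ α) {τ : ℝ} (htτ : t ≤ τ) (hτT : τ ≤ T) :
    IsAdmissible ε T (γ τ) τ γ α where
  absCont := h.absCont.mono (by
    rw [uIcc_of_le hτT, uIcc_of_le (htτ.trans hτT)]; exact Icc_subset_Icc_left htτ)
  memLp := h.memLp.mono_measure (Measure.restrict_mono (Icc_subset_Icc_left htτ) le_rfl)
  initial := rfl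
  dynamics := ae_mono (Measure.restrict_mono (Icc_subset_Icc_left htτ) le_rfl) h.dynamics

/-- The concatenation at time `τ`: `γ` up to `τ`, then `η`. -/
noncomputable def concat {E : Type*} (τ : ℝ) (γ η : ℝ → E) (s : ℝ) : E :=
  if s ≤ τ then γ s else η s

theorem concat_of_le {E : Type*} {τ s : ℝ} (γ η : ℝ → E) (h : s ≤ τ) : concat τ γ η s = γ s :=
  if_pos h

theorem concat_of_lt {E : Type*} {τ s : ℝ} (γ η : ℝ → E) (h : τ < s) : concat τ γ η s = η s :=
  if_neg h.not_ge

theorem concat_of_ge {E : Type*} {τ s : ℝ} {γ η : ℝ → E} (he : η τ = γ τ) (h : τ ≤ s) :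
    concat τ γ η s = η s := by
  rcases h.eq_or_lt with rfl | h
  · rw [concat_of_le _ _ le_rfl, he]
  · exact concat_of_lt _ _ h

theorem IsAdmissible.concat (h : IsAdmissible ε T x t γ α) {τ : ℝ} (htτ : t ≤ τ) (hτT : τ ≤ T)
    {η β : ℝ → R3} (h' : IsAdmissible ε T (γ τ) τ η β) :
    IsAdmissible ε T x t (concat τ γ η) (concat τ α β) := by
  have htT := htτ.trans hτT
  have hmem : MemLp (HeisenbergControl.concat τ α β) 2 (volume.restrict (Icc t T)) := by
    refine MemLp.piecewise (s := Iic τ) measurableSet_Iic ?_ ?_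
    · exact h.memLp.mono_measure Measure.restrict_le_self
    · rw [Measure.restrict_restrict measurableSet_Iic.compl]
      have hsub : (Iic τ)ᶜ ∩ Icc t T ⊆ Icc τ T := fun s hs =>
        ⟨(not_le.1 (show ¬ s ≤ τ from hs.1)).le, hs.2.2⟩
      exact h'.memLp.mono_measure (Measure.restrict_mono hsub le_rfl)
  have hdyn : ∀ᵐ s ∂(volume.restrict (Icc t T)),
      HasDerivAt (HeisenbergControl.concat τ γ η)
        (velocity ε (HeisenbergControl.concat τ γ η s) (HeisenbergControl.concat τ α β s)) s := by
    have h1 := h.dynamics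
    have h2 := h'.dynamics
    rw [ae_restrict_iff' measurableSet_Icc] at h1 h2 ⊢
    -- The glued curve may have a corner at `τ`; this single time is negligible.
    have h3 : ∀ᵐ s : ℝ, s ≠ τ := by simp [ae_iff, measure_singleton]
    filter_upwards [h1, h2, h3] with s h1 h2 h3 hs
    rcases lt_or_gt_of_ne h3 with hlt | hgt
    · rw [concat_of_le _ _ hlt.le, concat_of_le _ _ hlt.le]
      refine (h1 hs).congr_of_eventuallyEq ?_
      filter_upwards [Iio_mem_nhds hlt] with r hr
      exact concat_of_le _ _ (le_of_lt hr)
    · rw [concat_of_lt _ _ hgt, concat_of_lt _ _ hgt]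
      refine (h2 ⟨hgt.le, hs.2⟩).congr_of_eventuallyEq ?_
      filter_upwards [Ioi_mem_nhds hgt] with r hr
      exact concat_of_lt _ _ hr
  refine ⟨?_, hmem, ?_, hdyn⟩
  · have e1 := h.eq_add_integral htT
    have e2 := h'.eq_add_integral hτT
    -- Absolute continuity is obtained by writing the glued curve as `x` plus the primitive of the
    -- glued velocity.
    set w := HeisenbergControl.concat τ (fun s => velocity ε (γ s) (α s))
      (fun s => velocity ε (η s) (β s)) with hw
    have i1 : IntervalIntegrable w volume t τ := by
      refine (intervalIntegrable_mono_Icc (h.intervalIntegrable_velocity htT) htT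
        ⟨le_rfl, htT⟩ ⟨htτ, hτT⟩).congr fun s hs => ?_
      rw [uIoc_of_le htτ] at hs
      exact (concat_of_le (fun s => velocity ε (γ s) (α s)) _ hs.2).symm
    have i2 : IntervalIntegrable w volume τ T := by
      refine (h'.intervalIntegrable_velocity hτT).congr fun s hs => ?_
      rw [uIoc_of_le hτT] at hs
      exact (concat_of_lt _ (fun s => velocity ε (η s) (β s)) hs.1).symm
    have hac := (absolutelyContinuousOnInterval_const x t T).add
      (absolutelyContinuousOnInterval_integral htT (i1.trans i2))
    have c1 : ∀ s ∈ Icc t τ, ∫ r in t..s, w r = ∫ r in t..s, velocity ε (γ r) (α r) := by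
      intro s hs
      refine intervalIntegral.integral_congr fun r hr => ?_
      rw [uIcc_of_le hs.1] at hr
      exact concat_of_le _ _ (hr.2.trans hs.2)
    refine absolutelyContinuousOnInterval_congr hac fun s hs => ?_
    rw [uIcc_of_le htT] at hs
    simp only [Pi.add_apply]
    rcases le_or_gt s τ with hle | hgt
    · rw [c1 s ⟨hs.1, hle⟩, concat_of_le _ _ hle, e1 s hs]
    · rw [concat_of_lt _ _ hgt, e2 s ⟨hgt.le, hs.2⟩, e1 τ ⟨htτ, hτT⟩, add_assoc,
        ← c1 τ ⟨htτ, le_rfl⟩, ← intervalIntegral.integral_add_adjacent_intervals i1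
          (intervalIntegrable_mono_Icc i2 hτT ⟨le_rfl, hτT⟩ ⟨hgt.le, hs.2⟩)]
      congr 2
      refine intervalIntegral.integral_congr_ae (Eventually.of_forall fun r hr => ?_)
      rw [uIoc_of_le hgt.le] at hr
      exact concat_of_lt _ _ hr.1
  · rw [concat_of_le _ _ htτ, h.initial]

theorem IsAdmissible.cost_eq_add {f : ℝ → R3 → ℝ} {g : R3 → ℝ} (h : IsAdmissible ε T x t γ α)
    (hfg : CostHypothesis T f g) (ht : 0 ≤ t) {τ : ℝ} (htτ : t ≤ τ) (hτT : τ ≤ T) :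
    cost T f g t γ α =
      (∫ s in t..τ, ((1 / 2 : ℝ) * ‖α s‖ ^ 2 + f s (γ s))) + cost T f g τ γ α := by
  have htT := htτ.trans hτT
  have hi := h.intervalIntegrable_cost hfg ht htT
  unfold cost
  rw [← add_assoc, intervalIntegral.integral_add_adjacent_intervals
    (intervalIntegrable_mono_Icc hi htT ⟨le_rfl, htT⟩ ⟨htτ, hτT⟩)
    (intervalIntegrable_mono_Icc hi htT ⟨htτ, hτT⟩ ⟨htT, le_rfl⟩)]

theorem IsAdmissible.cost_concat {f : ℝ → R3 → ℝ} {g : R3 → ℝ} (h : IsAdmissible ε T x t γ α)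
    (hfg : CostHypothesis T f g) (ht : 0 ≤ t) {τ : ℝ} (htτ : t ≤ τ) (hτT : τ ≤ T)
    {η β : ℝ → R3} (h' : IsAdmissible ε T (γ τ) τ η β) :
    cost T f g t (HeisenbergControl.concat τ γ η) (HeisenbergControl.concat τ α β) =
      (∫ s in t..τ, ((1 / 2 : ℝ) * ‖α s‖ ^ 2 + f s (γ s))) + cost T f g τ η β := by
  rw [(h.concat htτ hτT h').cost_eq_add hfg ht htτ hτT]
  unfold cost
  congr 1
  · refine intervalIntegral.integral_congr fun s hs => ?_
    rw [uIcc_of_le htτ] at hs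
    simp only [concat_of_le _ _ hs.2]
  · rw [concat_of_ge h'.initial hτT]
    congr 1
    refine intervalIntegral.integral_congr_ae (Eventually.of_forall fun s hs => ?_)
    rw [uIoc_of_le hτT] at hs
    simp only [concat_of_lt _ _ hs.1]

/-- The dynamic programming principle for optimal pairs. -/
theorem IsOptimalPair.restrict {f : ℝ → R3 → ℝ} {g : R3 → ℝ} (h : IsOptimalPair ε T f g x t γ α)
    (hfg : CostHypothesis T f g) (ht : 0 ≤ t) {τ : ℝ} (htτ : t ≤ τ) (hτT : τ ≤ T) :
    IsOptimalPair ε T f g (γ τ) τ γ α := by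
  refine ⟨h.1.restrict htτ hτT, fun η β h' => ?_⟩
  have h1 := h.2 _ _ (h.1.concat htτ hτT h')
  rw [h.1.cost_concat hfg ht htτ hτT h', h.1.cost_eq_add hfg ht htτ hτT] at h1
  linarith

/-- The new tail costs no more than the old one, which is itself a competitor from `(γ τ, τ)`. -/
theorem IsOptimalPair.concat {f : ℝ → R3 → ℝ} {g : R3 → ℝ} (h : IsOptimalPair ε T f g x t γ α)
    (hfg : CostHypothesis T f g) (ht : 0 ≤ t) {τ : ℝ} (htτ : t ≤ τ) (hτT : τ ≤ T) {η β : ℝ → R3}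
    (h' : IsOptimalPair ε T f g (γ τ) τ η β) :
    IsOptimalPair ε T f g x t (concat τ γ η) (concat τ α β) := by
  refine ⟨h.1.concat htτ hτT h'.1, fun η' β' h'' => ?_⟩
  have h1 := h.2 _ _ h''
  have h2 := h'.2 _ _ (h.1.restrict htτ hτT)
  rw [h.1.cost_concat hfg ht htτ hτT h'.1]
  rw [h.1.cost_eq_add hfg ht htτ hτT] at h1
  linarith

end Admissible

/-! ### First variation of the cost -/

section FirstVariation

variable {ε T t : ℝ} {x : R3} {γ α : ℝ → R3} {f : ℝ → R3 → ℝ} {g : R3 → ℝ}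

/-- The change of control that moves a trajectory through `z` with control `a` in the direction
`ψ • e`, where `ψ` has derivative `χ`. -/
noncomputable def controlVariation (ε : ℝ) (e z a : R3) (χ ψ : ℝ) : R3 :=
  !₂[χ * e 0, χ * e 1,
    (χ * (e 2 + z 1 * e 0 - z 0 * e 1) + ψ * (e 1 * a 0 - e 0 * a 1)) / ε]

/-- The third control absorbs the change in `-x₂α₁ + x₁α₂`, which requires dividing by `ε`. The
identity is exact: the quadratic terms in `h` cancel because state and control move along the same
`e` in the first two coordinates. -/
theorem velocity_add_controlVariation (hε : ε ≠ 0) (e z a : R3) (χ ψ h : ℝ) :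
    velocity ε (z + h • ψ • e) (a + h • controlVariation ε e z a χ ψ) =
      velocity ε z a + h • χ • e := by
  ext i
  fin_cases i <;> simp [velocity, controlVariation]
  field_simp
  ring

theorem IsAdmissible.memLp_controlVariation (h : IsAdmissible ε T x t γ α) (htT : t ≤ T) (e : R3)
    {χ ψ : ℝ → ℝ} (hχ : Continuous χ) (hψ : Continuous ψ) :
    MemLp (fun s => controlVariation ε e (γ s) (α s) (χ s) (ψ s)) 2
      (volume.restrict (Icc t T)) := by
  have hα := fun i => h.memLp.eval_piLp i
  have hγ := h.continuousOn_apply htT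
  refine MemLp.of_eval_piLp fun i => ?_
  fin_cases i
  · simpa [controlVariation] using
      memLp_two_of_continuousOn (c := fun s => χ s * e 0) (a := t) (b := T) (by fun_prop)
  · simpa [controlVariation] using
      memLp_two_of_continuousOn (c := fun s => χ s * e 1) (a := t) (b := T) (by fun_prop)
  · have h1 : ContinuousOn (fun s => χ s * (e 2 + γ s 1 * e 0 - γ s 0 * e 1)) (Icc t T) := by
      have := hγ 0
      have := hγ 1
      fun_prop
    have h2 := memLp_two_continuousOn_mul (hψ.continuousOn (s := Icc t T))
      (((hα 0).const_mul (e 1)).sub ((hα 1).const_mul (e 0)))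
    simpa [controlVariation, div_eq_inv_mul] using!
      ((memLp_two_of_continuousOn h1).add h2).const_mul ε⁻¹

theorem IsAdmissible.variation (hε : ε ≠ 0) (h : IsAdmissible ε T x t γ α) (htT : t ≤ T) (e : R3)
    {χ ψ : ℝ → ℝ} (hχ : Continuous χ) (hψ : ∀ s, HasDerivAt ψ (χ s) s) (hψt : ψ t = 0) (k : ℝ) :
    IsAdmissible ε T x t (fun s => γ s + k • ψ s • e)
      (fun s => α s + k • controlVariation ε e (γ s) (α s) (χ s) (ψ s)) where
  absCont := by
    have hψ1 : ContDiff ℝ 1 ψ := by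
      rw [contDiff_one_iff_deriv, funext fun s => (hψ s).deriv]
      exact ⟨fun s => (hψ s).differentiableAt, hχ⟩
    have h2 : ContDiff ℝ 1 (fun s => k • ψ s • e) := by fun_prop
    exact h.absCont.add h2.contDiffOn.absolutelyContinuousOnInterval
  memLp := h.memLp.add ((h.memLp_controlVariation htT e hχ
    (continuous_iff_continuousAt.2 fun s => (hψ s).continuousAt)).const_smul k)
  initial := by simp [h.initial, hψt]
  dynamics := by
    filter_upwards [h.dynamics] with s hs
    rw [velocity_add_controlVariation hε]
    exact hs.add (((hψ s).smul_const e).const_smul k)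

theorem eq_zero_of_forall_linear_add_quadratic_nonneg {A B : ℝ}
    (h : ∀ k : ℝ, 0 ≤ k * A + k ^ 2 * B) : A = 0 := by
  by_contra hA
  have hd : 0 < |B| + 1 := by positivity
  -- A step against the sign of `A`, short enough for the linear term to beat the quadratic one;
  -- `|B| + 1` avoids any sign discussion on `B`.
  have h1 := h (-A / (|B| + 1))
  have h2 : -A / (|B| + 1) * A + (-A / (|B| + 1)) ^ 2 * B =
      -(A ^ 2 * (|B| + 1 - B)) / (|B| + 1) ^ 2 := by
    field_simp
    ring
  rw [h2] at h1
  have h3 : 0 < A ^ 2 * (|B| + 1 - B) / (|B| + 1) ^ 2 := by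
    have := le_abs_self B
    have : 0 < |B| + 1 - B := by linarith
    positivity
  rw [neg_div] at h1
  linarith

theorem inner_controlVariation (ε : ℝ) (e z a : R3) (χ ψ : ℝ) :
    inner ℝ a (controlVariation ε e z a χ ψ) =
      (a 0 * e 0 + a 1 * e 1 + a 2 / ε * (e 2 + z 1 * e 0 - z 0 * e 1)) * χ +
        a 2 / ε * (e 1 * a 0 - e 0 * a 1) * ψ := by
  simp [controlVariation, PiLp.inner_apply, Fin.sum_univ_three]
  ring

theorem IsAdmissible.intervalIntegrable_momentum (h : IsAdmissible ε T x t γ α) (htT : t ≤ T)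
    (e : R3) :
    IntervalIntegrable (fun s => α s 0 * e 0 + α s 1 * e 1 +
      α s 2 / ε * (e 2 + γ s 1 * e 0 - γ s 0 * e 1)) volume t T := by
  have hα := fun i => h.memLp.eval_piLp i
  have hγ := h.continuousOn_apply htT
  have h1 : ContinuousOn (fun s => ε⁻¹ * (e 2 + γ s 1 * e 0 - γ s 0 * e 1)) (Icc t T) := by
    have := hγ 0
    have := hγ 1
    fun_prop
  refine (intervalIntegrable_of_memLp_two htT
    ((((hα 0).mul_const (e 0)).add ((hα 1).mul_const (e 1))).add
      (memLp_two_continuousOn_mul h1 (hα 2)))).congr fun s _ => ?_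
  simp only [Pi.add_apply]
  ring

theorem IsAdmissible.intervalIntegrable_force (h : IsAdmissible ε T x t γ α)
    (hfg : CostHypothesis T f g) (ht : 0 ≤ t) (htT : t ≤ T) (e : R3) :
    IntervalIntegrable (fun s => α s 2 / ε * (e 1 * α s 0 - e 0 * α s 1) +
      fderiv ℝ (f s) (γ s) e) volume t T := by
  have hα := fun i => h.memLp.eval_piLp i
  refine IntervalIntegrable.add ?_ ?_
  · refine (intervalIntegrable_mul_of_memLp_two htT ((hα 2).mul_const ε⁻¹)
      (((hα 0).const_mul (e 1)).sub ((hα 1).const_mul (e 0)))).congr fun s _ => ?_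
    simp [div_eq_mul_inv]
  · refine ContinuousOn.intervalIntegrable ?_
    rw [uIcc_of_le htT]
    exact (continuousOn_graph hfg.continuousOn_fderiv ht le_rfl (h.continuousOn htT)).clm_apply
      continuousOn_const

/-- The first variation of the cost at an optimal pair vanishes. -/
theorem IsOptimalPair.firstVariation_eq_zero (hε : ε ≠ 0) (h : IsOptimalPair ε T f g x t γ α)
    (hfg : CostHypothesis T f g) (ht : 0 ≤ t) (htT : t ≤ T) (e : R3) {χ ψ : ℝ → ℝ}
    (hχ : Continuous χ) (hψ : ∀ s, HasDerivAt ψ (χ s) s) (hψt : ψ t = 0) (hψT : ψ T = 0) :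
    ∫ s in t..T, ((α s 0 * e 0 + α s 1 * e 1 +
        α s 2 / ε * (e 2 + γ s 1 * e 0 - γ s 0 * e 1)) * χ s +
      (α s 2 / ε * (e 1 * α s 0 - e 0 * α s 1) + fderiv ℝ (f s) (γ s) e) * ψ s) = 0 := by
  have hψc : Continuous ψ := continuous_iff_continuousAt.2 fun s => (hψ s).continuousAt
  obtain ⟨C, hC⟩ := hfg.exists_quadratic_upper_bound
  set β : ℝ → R3 := fun s => controlVariation ε e (γ s) (α s) (χ s) (ψ s) with hβ
  set A : ℝ → ℝ := fun s => (α s 0 * e 0 + α s 1 * e 1 +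
        α s 2 / ε * (e 2 + γ s 1 * e 0 - γ s 0 * e 1)) * χ s +
      (α s 2 / ε * (e 1 * α s 0 - e 0 * α s 1) + fderiv ℝ (f s) (γ s) e) * ψ s with hA
  set B : ℝ → ℝ := fun s => 1 / 2 * ‖β s‖ ^ 2 + C * ‖ψ s • e‖ ^ 2 with hB
  have hAi : IntervalIntegrable A volume t T :=
    ((h.1.intervalIntegrable_momentum htT e).mul_continuousOn hχ.continuousOn).add
      ((h.1.intervalIntegrable_force hfg ht htT e).mul_continuousOn hψc.continuousOn)
  have hBi : IntervalIntegrable B volume t T := by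
    refine IntervalIntegrable.add ?_ ?_
    · exact ((intervalIntegrable_iff_integrableOn_Icc_of_le htT).2
        (h.1.memLp_controlVariation htT e hχ hψc).norm.integrable_sq).const_mul _
    · exact Continuous.intervalIntegrable (by fun_prop) _ _
  -- The cost of the variation of size `k` exceeds the optimal cost by at most `k ∫ A + k² ∫ B`,
  -- which is therefore nonnegative for every `k`. The terminal cost drops out since `ψ T = 0`.
  refine eq_zero_of_forall_linear_add_quadratic_nonneg (B := ∫ s in t..T, B s) fun k => ?_
  have hk := h.1.variation hε htT e hχ hψ hψt k
  have h1 := h.2 _ _ hk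
  have i0 := h.1.intervalIntegrable_cost hfg ht htT
  have ik := hk.intervalIntegrable_cost hfg ht htT
  unfold cost at h1
  simp only [hψT, zero_smul, smul_zero, add_zero] at h1
  have h2 := intervalIntegral.integral_mono_on htT ik
    ((i0.add (hAi.const_mul k)).add (hBi.const_mul (k ^ 2))) fun s hs => ?_
  · rw [intervalIntegral.integral_add (i0.add (hAi.const_mul k)) (hBi.const_mul (k ^ 2)),
      intervalIntegral.integral_add i0 (hAi.const_mul k), intervalIntegral.integral_const_mul,
      intervalIntegral.integral_const_mul] at h2
    linarith
  · have h3 := hC s ⟨ht.trans hs.1, hs.2⟩ (γ s) (k • ψ s • e)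
    have h4 := norm_add_sq_real (α s) (k • β s)
    rw [inner_smul_right, inner_controlVariation, norm_smul k, mul_pow, Real.norm_eq_abs,
      sq_abs] at h4
    rw [norm_smul k, mul_pow, Real.norm_eq_abs, sq_abs, map_smul, map_smul, smul_eq_mul,
      smul_eq_mul] at h3
    simp only [hA, hB]
    simp only [hβ] at h4 ⊢
    rw [h4]
    linarith

end FirstVariation

/-! ### Costate, Hamiltonian system and non-branching -/

section Costate

variable {ε T t : ℝ} {x : R3} {γ α : ℝ → R3} {f : ℝ → R3 → ℝ} {g : R3 → ℝ}

/-- The control `B^ε(x)ᵀ p` determined by the state `x` and the costate `p`. -/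
noncomputable def feedback (ε : ℝ) (x p : R3) : R3 :=
  !₂[p 0 - x 1 * p 2, p 1 + x 0 * p 2, ε * p 2]

theorem feedback_injective (hε : ε ≠ 0) (x : R3) : Function.Injective (feedback ε x) := by
  intro p q h
  have h2 : p 2 = q 2 := by
    have := congrArg (fun v : R3 => v 2) h
    simpa [feedback, hε] using this
  have h0 := congrArg (fun v : R3 => v 0) h
  have h1 := congrArg (fun v : R3 => v 1) h
  simp only [feedback, Matrix.cons_val_zero, Matrix.cons_val_one, h2] at h0 h1
  ext i
  fin_cases i
  · exact sub_left_injective h0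
  · exact add_left_injective _ h1
  · exact h2

/-- The part of the Hamiltonian vector field that does not involve the running cost. -/
noncomputable def kineticField (ε : ℝ) (z : R3 × R3) : R3 × R3 :=
  (velocity ε z.1 (feedback ε z.1 z.2),
    !₂[z.2 2 * -feedback ε z.1 z.2 1, z.2 2 * feedback ε z.1 z.2 0, 0])

/-- The vector field governing state and costate along an optimal trajectory. -/
noncomputable def hamiltonianField (ε : ℝ) (f : ℝ → R3 → ℝ) (s : ℝ) (z : R3 × R3) : R3 × R3 :=
  kineticField ε z + (0, gradient (f s) z.1)

theorem contDiff_kineticField (ε : ℝ) : ContDiff ℝ 1 (kineticField ε) := by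
  refine ContDiff.prodMk (contDiff_euclidean.2 fun i => ?_) (contDiff_euclidean.2 fun i => ?_) <;>
  fin_cases i <;> simp [velocity, feedback] <;> fun_prop

theorem CostHypothesis.continuousOn_gradient (h : CostHypothesis T f g) :
    ContinuousOn (fun p : ℝ × R3 => gradient (f p.1) p.2) (Icc 0 T ×ˢ univ) :=
  (InnerProductSpace.toDual ℝ R3).symm.continuous.comp_continuousOn h.continuousOn_fderiv

theorem CostHypothesis.exists_lipschitz_gradient (h : CostHypothesis T f g) :
    ∃ C : NNReal, ∀ s ∈ Icc 0 T, LipschitzWith C (gradient (f s)) := by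
  obtain ⟨C, hC⟩ := h.exists_lipschitz
  refine ⟨C, fun s hs => ?_⟩
  have := (InnerProductSpace.toDual ℝ R3).symm.lipschitz.comp (hC s hs).2
  rwa [one_mul] at this

theorem gradient_apply {F : R3 → ℝ} (z : R3) (i : Fin 3) :
    gradient F z i = fderiv ℝ F z (EuclideanSpace.single i 1) := by
  rw [← InnerProductSpace.toDual_symm_apply (𝕜 := ℝ), EuclideanSpace.inner_single_right]
  simp [gradient]

theorem exists_lipschitzOnWith_hamiltonianField (ε : ℝ) (h : CostHypothesis T f g) (R : ℝ) :
    ∃ K : NNReal, ∀ s ∈ Icc 0 T,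
      LipschitzOnWith K (hamiltonianField ε f s) (Metric.closedBall 0 R) := by
  obtain ⟨K, hK⟩ := ((contDiff_kineticField ε).locallyLipschitz.locallyLipschitzOn
    (s := Metric.closedBall 0 R)).exists_lipschitzOnWith_of_compact (isCompact_closedBall _ _)
  obtain ⟨C, hC⟩ := h.exists_lipschitz_gradient
  refine ⟨K + max 0 (C * 1), fun s hs => hK.add ?_⟩
  exact (LipschitzWith.prodMk (LipschitzWith.const 0)
    ((hC s hs).comp LipschitzWith.prod_fst)).lipschitzOnWith

theorem CostHypothesis.continuousOn_hamiltonianField (h : CostHypothesis T f g) (ht : 0 ≤ t)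
    {p : ℝ → R3} (hγ : ContinuousOn γ (Icc t T)) (hp : ContinuousOn p (Icc t T)) :
    ContinuousOn (fun s => hamiltonianField ε f s (γ s, p s)) (Icc t T) :=
  ((contDiff_kineticField ε).continuous.comp_continuousOn (hγ.prodMk hp)).add
    (continuousOn_const.prodMk (continuousOn_graph h.continuousOn_gradient ht le_rfl hγ))

/-- The Pontryagin principle: along an optimal pair there is a costate which determines the
control and solves, together with the trajectory, the Hamiltonian system. -/
theorem IsOptimalPair.exists_costate (hε : ε ≠ 0) (h : IsOptimalPair ε T f g x t γ α)
    (hfg : CostHypothesis T f g) (ht : 0 ≤ t) (htT : t < T) :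
    ∃ p : ℝ → R3, ContinuousOn p (Icc t T) ∧
      (∀ᵐ s ∂(volume.restrict (Icc t T)), α s = feedback ε (γ s) (p s)) ∧
      ∀ s ∈ Ico t T, HasDerivWithinAt (fun s => (γ s, p s))
        (hamiltonianField ε f s (γ s, p s)) (Ici s) s := by
  have hγ := h.1.continuousOn htT.le
  have hforce := h.1.intervalIntegrable_force hfg ht htT.le
  -- The future derivative of the costate, with its third component still written as `α₃ / ε`. Its
  -- coordinates are the coefficients of `ψ` in the first variation along the basis vectors.
  set N : ℝ → R3 := fun s =>
    !₂[α s 2 / ε * -α s 1, α s 2 / ε * α s 0, 0] + gradient (f s) (γ s) with hN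
  have hNi : ∀ i s, N s i =
      α s 2 / ε * ((EuclideanSpace.single i 1 : R3) 1 * α s 0 -
        (EuclideanSpace.single i 1 : R3) 0 * α s 1) +
      fderiv ℝ (f s) (γ s) (EuclideanSpace.single i 1) := by
    intro i s
    simp only [hN, PiLp.add_apply, gradient_apply]
    fin_cases i <;> simp
  have hNint : IntervalIntegrable N volume t T := by
    rw [intervalIntegrable_iff_integrableOn_Icc_of_le htT.le]
    refine Integrable.of_eval_piLp fun i => ?_
    simp only [hNi]
    exact (intervalIntegrable_iff_integrableOn_Icc_of_le htT.le).1 (hforce _)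
  have hdb : ∀ i : Fin 3, ∃ c : ℝ, ∀ᵐ s ∂(volume.restrict (Icc t T)),
      α s 0 * (EuclideanSpace.single i 1 : R3) 0 + α s 1 * (EuclideanSpace.single i 1 : R3) 1 +
        α s 2 / ε * ((EuclideanSpace.single i 1 : R3) 2 +
          γ s 1 * (EuclideanSpace.single i 1 : R3) 0 -
          γ s 0 * (EuclideanSpace.single i 1 : R3) 1) = c + ∫ r in t..s, N r i := by
    intro i
    simp only [hNi]
    refine ae_eq_const_add_integral_of_forall_integral_eq_zero htT
      (h.1.intervalIntegrable_momentum htT.le _) (hforce _) fun χ hχ h0 => ?_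
    exact h.firstVariation_eq_zero hε hfg ht htT.le (EuclideanSpace.single i 1) hχ
      (fun s => intervalIntegral.integral_hasDerivAt_right (hχ.intervalIntegrable _ _)
        (hχ.stronglyMeasurableAtFilter _ _) hχ.continuousAt)
      intervalIntegral.integral_same h0
  choose c hc using hdb
  -- With this `p`, the three du Bois-Reymond identities form a linear system for `α`, solved a.e.
  -- by `feedback ε (γ s) (p s)`.
  set p : ℝ → R3 := fun s => WithLp.toLp 2 c + ∫ r in t..s, N r with hp
  have hpc : ContinuousOn p (Icc t T) := by
    have := (absolutelyContinuousOnInterval_integral htT.le hNint).continuousOn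
    rw [uIcc_of_le htT.le] at this
    exact continuousOn_const.add this
  have hpi : ∀ s ∈ Icc t T, ∀ i, p s i = c i + ∫ r in t..s, N r i := fun s hs i => by
    rw [← intervalIntegral_euclidean_apply
      (intervalIntegrable_mono_Icc hNint htT.le ⟨le_rfl, htT.le⟩ hs)]
    rfl
  have hae : ∀ᵐ s ∂(volume.restrict (Icc t T)),
      α s = feedback ε (γ s) (p s) ∧ p s 2 = α s 2 / ε := by
    filter_upwards [hc 0, hc 1, hc 2, ae_restrict_mem measurableSet_Icc] with s h0 h1 h2 hs
    rw [← hpi s hs] at h0 h1 h2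
    simp at h0 h1 h2
    refine ⟨?_, h2.symm⟩
    ext i
    fin_cases i
    · simp [feedback, ← h0, ← h2]; ring
    · simp [feedback, ← h1, ← h2]; ring
    · simp [feedback, ← h2]; field_simp
  refine ⟨p, hpc, hae.mono fun s hs => hs.1, fun s hs => ?_⟩
  -- The control is known only a.e., but replacing it by the continuous feedback does not change the
  -- integrals, so the system holds at every time.
  have hae' : ∀ᵐ s, s ∈ Icc t T →
      (velocity ε (γ s) (α s), N s) = hamiltonianField ε f s (γ s, p s) := by
    rw [← ae_restrict_iff' measurableSet_Icc]
    filter_upwards [hae] with s hs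
    simp only [hamiltonianField, kineticField, ← hs.1, hs.2, hN, Prod.mk_add_mk, add_zero]
  have hfield := hfg.continuousOn_hamiltonianField (ε := ε) ht hγ hpc
  refine HasDerivWithinAt.prodMk
    (hasDerivWithinAt_Ici_of_eq_add_integral (continuous_fst.comp_continuousOn hfield)
      (fun r hr => ?_) hs)
    (hasDerivWithinAt_Ici_of_eq_add_integral (continuous_snd.comp_continuousOn hfield)
      (fun r hr => ?_) hs)
  · rw [h.1.eq_add_integral htT.le r hr, h.1.initial]
    congr 1
    refine intervalIntegral.integral_congr_ae (hae'.mono fun q hq hqr => ?_)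
    rw [uIoc_of_le hr.1] at hqr
    exact congrArg Prod.fst (hq ⟨hqr.1.le, hqr.2.trans hr.2⟩)
  · simp only [hp, intervalIntegral.integral_same, add_zero]
    congr 1
    refine intervalIntegral.integral_congr_ae (hae'.mono fun q hq hqr => ?_)
    rw [uIoc_of_le hr.1] at hqr
    exact congrArg Prod.snd (hq ⟨hqr.1.le, hqr.2.trans hr.2⟩)

/-- Two optimal pairs from the same point that agree up to time `τ > t` have the same
trajectory. -/
theorem IsOptimalPair.eqOn_of_eqOn (hε : ε ≠ 0) {η β : ℝ → R3}
    (h : IsOptimalPair ε T f g x t γ α) (h' : IsOptimalPair ε T f g x t η β)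
    (hfg : CostHypothesis T f g) (ht : 0 ≤ t) {τ : ℝ} (htτ : t < τ) (hτT : τ ≤ T)
    (hγη : EqOn γ η (Icc t τ)) (hαβ : EqOn α β (Icc t τ)) : EqOn γ η (Icc τ T) := by
  have htT := htτ.trans_le hτT
  obtain ⟨p, hpc, hpα, hpd⟩ := h.exists_costate hε hfg ht htT
  obtain ⟨q, hqc, hqβ, hqd⟩ := h'.exists_costate hε hfg ht htT
  obtain ⟨σ, hσ, hpq⟩ : ∃ σ ∈ Icc t τ, p σ = q σ := by
    have hle : volume.restrict (Icc t τ) ≤ volume.restrict (Icc t T) :=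
      Measure.restrict_mono (Icc_subset_Icc_right hτT) le_rfl
    -- `[t, τ]` has positive measure, so some time in it satisfies both a.e. feedback formulas.
    have hne : (ae (volume.restrict (Icc t τ))).NeBot := by
      rw [ae_neBot, Ne, Measure.restrict_eq_zero, Real.volume_Icc]
      simpa using htτ
    obtain ⟨σ, ⟨h1, h2⟩, hσ⟩ := ((hpα.filter_mono (ae_mono hle)).and
      (hqβ.filter_mono (ae_mono hle)) |>.and (ae_restrict_mem measurableSet_Icc)).exists
    refine ⟨σ, hσ, feedback_injective hε (γ σ) ?_⟩
    rw [← h1, hαβ hσ, h2, hγη hσ]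
  have hsub : Icc σ T ⊆ Icc t T := Icc_subset_Icc_left hσ.1
  have c1 := ((h.1.continuousOn htT.le).prodMk hpc).mono hsub
  have c2 := ((h'.1.continuousOn htT.le).prodMk hqc).mono hsub
  -- The field is only locally Lipschitz, so both solutions are first confined to a common ball.
  obtain ⟨R1, hR1⟩ := isCompact_Icc.exists_bound_of_continuousOn c1
  obtain ⟨R2, hR2⟩ := isCompact_Icc.exists_bound_of_continuousOn c2
  obtain ⟨K, hK⟩ := exists_lipschitzOnWith_hamiltonianField ε hfg (max R1 R2)
  have huniq := ODE_solution_unique_of_mem_Icc_right (v := hamiltonianField ε f)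
    (s := fun _ => Metric.closedBall 0 (max R1 R2)) (K := K)
    (fun s hs => hK s ⟨(ht.trans hσ.1).trans hs.1, hs.2.le⟩) c1
    (fun s hs => hpd s ⟨hσ.1.trans hs.1, hs.2⟩)
    (fun s hs => mem_closedBall_zero_iff.2 ((hR1 s ⟨hs.1, hs.2.le⟩).trans (le_max_left _ _))) c2
    (fun s hs => hqd s ⟨hσ.1.trans hs.1, hs.2⟩)
    (fun s hs => mem_closedBall_zero_iff.2 ((hR2 s ⟨hs.1, hs.2.le⟩).trans (le_max_right _ _)))
    (by rw [hpq, hγη hσ])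
  exact fun s hs => congrArg Prod.fst (huniq ⟨hσ.2.trans hs.1, hs.2⟩)

end Costate

end HeisenbergControl

theorem proposition3p3
    (ε T : ℝ) (hε : ε ≠ 0)
    (f : ℝ → HeisenbergControl.R3 → ℝ) (g : HeisenbergControl.R3 → ℝ)
    (hfg : HeisenbergControl.CostHypothesis T f g)
    (x : HeisenbergControl.R3) (t : ℝ) (ht : 0 ≤ t)
    (xs : ℝ → HeisenbergControl.R3)
    (hxs : HeisenbergControl.IsOptimalTrajectory ε T f g x t xs)
    (τ : ℝ) (htτ : t < τ) (hτT : τ < T) :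
    HeisenbergControl.IsOptimalTrajectory ε T f g (xs τ) τ xs ∧
      ∀ y : ℝ → HeisenbergControl.R3,
        HeisenbergControl.IsOptimalTrajectory ε T f g (xs τ) τ y →
          Set.EqOn y xs (Set.Icc τ T) := by
  obtain ⟨α, hα⟩ := hxs
  refine ⟨⟨α, hα.restrict hfg ht htτ.le hτT.le⟩, ?_⟩
  rintro y ⟨β, hβ⟩ s hs
  have h := hα.eqOn_of_eqOn hε (hα.concat hfg ht htτ.le hτT.le hβ) hfg ht htτ hτT.le
    (fun r hr => (HeisenbergControl.concat_of_le _ _ hr.2).symm)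
    (fun r hr => (HeisenbergControl.concat_of_le _ _ hr.2).symm) hs
  rw [h, HeisenbergControl.concat_of_ge hβ.1.initial hs.1]
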